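/- Let $n,m\in\mathbb N$, $\gamma>0$, $L\ge 0$, and let $f:\mathbb R^n\times\mathbb R^m\to\mathbb R^n$ and $r:\mathbb R^n\times\mathbb R^m\to\mathbb R$ be bounded and Lipschitz continuous. Let $\mathcal A$ be the set of Lipschitz continuous controls $a:[0,\infty)\to\mathbb R^m$ with $|\dot a(t)|\le L$ for a.e. $t$, and define $$Q(\boldsymbol x,\boldsymbol a):=\sup\Big\{\int_0^\infty e^{-\gamma t}r(x(t),a(t))\,dt \;:\; a\in\mathcal A,\ a(0)=\boldsymbol a,\ \dot x(t)=f(x(t),a(t))\ (t>0),\ x(0)=\boldsymbol x\Big\}.$$ For $h>0$ let $\xi(\boldsymbol x,\boldsymbol a;h)$ be the state at time $h$ of $\dot x=f(x,\boldsymbol a)$, $x(0)=\boldsymbol x$, with the constant action $\boldsymbol a$. For a sequence $b=(b_k)_{k\ge0}$ in $\mathbb R^m$ with $|b_k|\le L$ for all $k$, set $(x_0,a_0)=(\boldsymbol x,\boldsymbol a)$, $x_{k+1}=\xi(x_k,a_k;h)$, $a_{k+1}=a_k+hb_k$, and $$Q^{h,b}(\boldsymbol x,\boldsymbol a):=h\sum_{k=0}^\infty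 r(x_k,a_k)(1-\gamma h)^k,\qquad Q^{h,\star}(\boldsymbol x,\boldsymbol a):=\sup_{b}Q^{h,b}(\boldsymbol x,\boldsymbol a).$$ Then, for every $h$ with $0<h<1/\gamma$, the function $Q^{h,\star}$ is bounded, it solves the semi-discrete HJB equation $$q(\boldsymbol x,\boldsymbol a)=h\,r(\boldsymbol x,\boldsymbol a)+(1-\gamma h)\sup_{|\boldsymbol b|\le L}q\big(\xi(\boldsymbol x,\boldsymbol a;h),\boldsymbol a+h\boldsymbol b\big)\qquad\text{for all }(\boldsymbol x,\boldsymbol a)\in\mathbb R^n\times\mathbb R^m,$$ and it is the only bounded function $q:\mathbb R^n\times\mathbb R^m\to\mathbb R$ that solves it. Furthermore, for every compact $K\subset\mathbb R^n\times\mathbb R^m$, $$\lim_{h\to0^+}\ \sup_{(\boldsymbol x,\boldsymbol a)\in K}\big|Q^{h,\star}(\boldsymbol x,\boldsymbol a)-Q(\boldsymbol x,\boldsymbol a)\big|=0.$$ -/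

import Mathlib

noncomputable section

namespace HJQ

variable {n m : ℕ}

/-- `g` is bounded and (globally) Lipschitz continuous. -/
def IsBoundedLipschitz {X Y : Type*} [PseudoEMetricSpace X] [NormedAddCommGroup Y]
    (g : X → Y) : Prop :=
  (∃ C : ℝ, ∀ z, ‖g z‖ ≤ C) ∧ ∃ K : NNReal, LipschitzWith K g

/-- Admissible controls: Lipschitz continuous functions of time `t ≥ 0` whose derivative satisfies
`|a'(t)| ≤ L` for almost every `t ≥ 0`. Only the values on `[0, ∞)` matter. -/
def IsAdmissible (L : ℝ) (a : ℝ → EuclideanSpace ℝ (Fin m)) : Prop :=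
  (∃ K : NNReal, LipschitzOnWith K a (Set.Ici 0)) ∧
    ∀ᵐ t ∂(MeasureTheory.volume.restrict (Set.Ici (0 : ℝ))), ‖deriv a t‖ ≤ L

/-- `x` solves `x'(t) = f (x(t), a(t))` for `t > 0`, and `x` is continuous on `[0, ∞)` with
`x(0) = x₀`. -/
def IsTrajectory
    (f : EuclideanSpace ℝ (Fin n) × EuclideanSpace ℝ (Fin m) → EuclideanSpace ℝ (Fin n))
    (a : ℝ → EuclideanSpace ℝ (Fin m)) (x₀ : EuclideanSpace ℝ (Fin n))
    (x : ℝ → EuclideanSpace ℝ (Fin n)) : Prop :=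
  x 0 = x₀ ∧ ContinuousOn x (Set.Ici 0) ∧ ∀ t : ℝ, 0 < t → HasDerivAt x (f (x t, a t)) t

/-- The continuous-time Q-function: the supremum of the discounted reward
`∫_0^∞ e^{-γ t} r (x(t), a(t)) dt` over the admissible controls with `a(0) = z.2`, where `x` is the
trajectory with `x(0) = z.1` under the control `a`. -/
def qFun (f : EuclideanSpace ℝ (Fin n) × EuclideanSpace ℝ (Fin m) → EuclideanSpace ℝ (Fin n))
    (r : EuclideanSpace ℝ (Fin n) × EuclideanSpace ℝ (Fin m) → ℝ) (γ L : ℝ)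
    (z : EuclideanSpace ℝ (Fin n) × EuclideanSpace ℝ (Fin m)) : ℝ :=
  sSup {J : ℝ | ∃ (a : ℝ → EuclideanSpace ℝ (Fin m)) (x : ℝ → EuclideanSpace ℝ (Fin n)),
    IsAdmissible L a ∧ a 0 = z.2 ∧ IsTrajectory f a z.1 x ∧
      J = ∫ t in Set.Ioi (0 : ℝ), Real.exp (-γ * t) * r (x t, a t)}

/-- `ξ(x, a; h)`: the state at time `h` of the system started at `z.1` under the constant action
`z.2`. (The trajectory exists and is unique on `[0, ∞)` when `f` is Lipschitz.) -/
def xi (f : EuclideanSpace ℝ (Fin n) × EuclideanSpace ℝ (Fin m) → EuclideanSpace ℝ (Fin n))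
    (h : ℝ) (z : EuclideanSpace ℝ (Fin n) × EuclideanSpace ℝ (Fin m)) :
    EuclideanSpace ℝ (Fin n) :=
  Classical.epsilon
    (fun x : ℝ → EuclideanSpace ℝ (Fin n) => IsTrajectory f (fun _ => z.2) z.1 x) h

/-- The sequence `(x_k, a_k)`: `x_{k+1} = ξ(x_k, a_k; h)`, `a_{k+1} = a_k + h b_k`, started at
`(x_0, a_0) = z`. -/
def semiSeq (f : EuclideanSpace ℝ (Fin n) × EuclideanSpace ℝ (Fin m) → EuclideanSpace ℝ (Fin n))
    (h : ℝ) (b : ℕ → EuclideanSpace ℝ (Fin m))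
    (z : EuclideanSpace ℝ (Fin n) × EuclideanSpace ℝ (Fin m)) :
    ℕ → EuclideanSpace ℝ (Fin n) × EuclideanSpace ℝ (Fin m)
  | 0 => z
  | k + 1 => (xi f h (semiSeq f h b z k), (semiSeq f h b z k).2 + h • b k)

/-- `Q^{h,b}(z) = h ∑_k r(x_k, a_k) (1 - γ h)^k`. -/
def semiReturn
    (f : EuclideanSpace ℝ (Fin n) × EuclideanSpace ℝ (Fin m) → EuclideanSpace ℝ (Fin n))
    (r : EuclideanSpace ℝ (Fin n) × EuclideanSpace ℝ (Fin m) → ℝ) (γ h : ℝ)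
    (b : ℕ → EuclideanSpace ℝ (Fin m))
    (z : EuclideanSpace ℝ (Fin n) × EuclideanSpace ℝ (Fin m)) : ℝ :=
  h * ∑' k : ℕ, r (semiSeq f h b z k) * (1 - γ * h) ^ k

/-- The optimal semi-discrete Q-function `Q^{h,⋆}`: the supremum of `Q^{h,b}` over the sequences
`b` with `|b_k| ≤ L` for all `k`. -/
def semiQ (f : EuclideanSpace ℝ (Fin n) × EuclideanSpace ℝ (Fin m) → EuclideanSpace ℝ (Fin n))
    (r : EuclideanSpace ℝ (Fin n) × EuclideanSpace ℝ (Fin m) → ℝ) (γ L h : ℝ)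
    (z : EuclideanSpace ℝ (Fin n) × EuclideanSpace ℝ (Fin m)) : ℝ :=
  ⨆ b : {b : ℕ → EuclideanSpace ℝ (Fin m) // ∀ k, ‖b k‖ ≤ L}, semiReturn f r γ h b.1 z

/-- `q` solves the semi-discrete HJB equation
`q(x, a) = h r(x, a) + (1 - γ h) sup_{|b| ≤ L} q(ξ(x, a; h), a + h b)` for all `(x, a)`. -/
def SolvesSemiHJB
    (f : EuclideanSpace ℝ (Fin n) × EuclideanSpace ℝ (Fin m) → EuclideanSpace ℝ (Fin n))
    (r : EuclideanSpace ℝ (Fin n) × EuclideanSpace ℝ (Fin m) → ℝ) (γ L h : ℝ)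
    (q : EuclideanSpace ℝ (Fin n) × EuclideanSpace ℝ (Fin m) → ℝ) : Prop :=
  ∀ z, q z = h * r z +
    (1 - γ * h) * ⨆ b : {b : EuclideanSpace ℝ (Fin m) // ‖b‖ ≤ L}, q (xi f h z, z.2 + h • b.1)

/-- `q` is a bounded function. -/
def IsBoundedFun (q : EuclideanSpace ℝ (Fin n) × EuclideanSpace ℝ (Fin m) → ℝ) : Prop :=
  ∃ M : ℝ, ∀ z, |q z| ≤ M

end HJQ

end

/-! For fixed `h` the equation is handled by dynamic programming. Peeling the first term off the
series gives a one-step identity for each slope sequence (`semiReturn_eq`). Taking suprema over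
first slope and tail separately yields the equation for `semiQ`. Two bounded solutions coincide
because the right-hand side is a sup-norm contraction with factor `1 - γ * h`.

For the limit, admissible controls are exactly the `L`-Lipschitz ones on `[0, ∞)`. Sampling such a
control on the grid `h * k` gives slopes bounded by `L`, and conversely bounded slopes are
interpolated by a piecewise linear admissible control. For a matched pair the actions agree on the
grid, and a discrete Gronwall estimate keeps the states within `O(h * exp (K * t))` of each other.
Hence the two returns differ by at most `∫ defect` (`abs_integral_sub_semiReturn_le`), a bound
independent of the initial point and of the control. It therefore passes to both suprema
(`abs_qFun_sub_semiQ_le`).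

The factor `exp (K * t)` may outgrow the discount. The reward error is therefore also capped by `2 *
C`, and `∫ defect → 0` follows by dominated convergence rather than from an explicit rate. -/

namespace HJQ

open Set MeasureTheory Filter
open scoped Topology NNReal

/-! ### Admissible controls and global trajectories -/

/-- Mean value inequality with a two-sided derivative on the open interval only. -/
theorem norm_sub_le_of_hasDerivAt_Ioo {E : Type*} [NormedAddCommGroup E] [NormedSpace ℝ E]
    {g g' : ℝ → E} {a b C : ℝ} (hab : a ≤ b) (hc : ContinuousOn g (Icc a b))
    (hd : ∀ t ∈ Ioo a b, HasDerivAt g (g' t) t) (hB : ∀ t ∈ Ioo a b, ‖g' t‖ ≤ C) :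
    ‖g b - g a‖ ≤ C * (b - a) := by
  have := norm_sub_le_integral_of_norm_deriv_le_of_le (B := fun _ => C) hab hc
    (fun t ht => (hd t ht).differentiableAt.differentiableWithinAt)
    (ae_of_all _ fun t ht => by rw [(hd t ht).deriv]; exact hB t ht) (by simp)
  simpa [mul_comm] using this

/-- An admissible control is `L`-Lipschitz on `[0, ∞)`. -/
theorem IsAdmissible.norm_sub_le {m : ℕ} {L : ℝ} {a : ℝ → EuclideanSpace ℝ (Fin m)}
    (ha : IsAdmissible L a) (hL : 0 ≤ L) {s t : ℝ} (hs : 0 ≤ s) (hst : s ≤ t) :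
    ‖a t - a s‖ ≤ L * (t - s) := by
  obtain ⟨⟨K, hK⟩, hae⟩ := ha
  -- Pairing with the increment `v` itself gives a scalar Lipschitz, hence absolutely continuous,
  -- function. The fundamental theorem of calculus then yields `‖v‖ ^ 2 ≤ ‖v‖ * L * (t - s)`.
  set v := a t - a s with hv
  have hsub : Icc s t ⊆ Ici 0 := fun u hu => hs.trans hu.1
  have hKst : LipschitzOnWith K a (uIcc s t) := by
    rw [uIcc_of_le hst]; exact hK.mono hsub
  have hg : AbsolutelyContinuousOnInterval (fun u => inner ℝ v (a u)) s t :=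
    ((innerSL ℝ v).lipschitz.comp_lipschitzOnWith hKst).absolutelyContinuousOnInterval
  have hint := hg.integral_deriv_eq_sub
  rw [← inner_sub_right, ← hv, real_inner_self_eq_norm_sq] at hint
  have hbd : ‖∫ u in s..t, deriv (fun u => inner ℝ v (a u)) u‖ ≤ (‖v‖ * L) * |t - s| := by
    refine intervalIntegral.norm_integral_le_of_norm_le_const_ae ?_
    have h1 := (ae_restrict_iff' measurableSet_Ici).1 hae
    have h2 := hK.ae_differentiableWithinAt_of_mem_real
    filter_upwards [h1, h2] with u hu1 hu2 hu
    rw [uIoc_of_le hst] at hu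
    have hu0 : 0 < u := hs.trans_lt hu.1
    have hd : DifferentiableAt ℝ a u := (hu2 hu0.le).differentiableAt (Ici_mem_nhds hu0)
    have : HasDerivAt (fun u => inner ℝ v (a u)) (inner ℝ v (deriv a u)) u :=
      (innerSL ℝ v).hasFDerivAt.comp_hasDerivAt u hd.hasDerivAt
    rw [this.deriv]
    exact (norm_inner_le_norm _ _).trans
      (mul_le_mul_of_nonneg_left (hu1 hu0.le) (norm_nonneg _))
  rw [hint, abs_of_nonneg (sub_nonneg.2 hst), Real.norm_of_nonneg (by positivity)] at hbd
  rcases (norm_nonneg v).eq_or_lt with h0 | h0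
  · rw [← h0]
    exact mul_nonneg hL (sub_nonneg.2 hst)
  · nlinarith

/-- Converse of the preceding bound: later estimates can work with the increment inequality alone,
without derivatives of the control. -/
theorem isAdmissible_of_norm_sub_le {m : ℕ} {L : ℝ} (hL : 0 ≤ L)
    {a : ℝ → EuclideanSpace ℝ (Fin m)}
    (ha : ∀ s t, 0 ≤ s → s ≤ t → ‖a t - a s‖ ≤ L * (t - s)) : IsAdmissible L a := by
  have hlip : LipschitzOnWith L.toNNReal a (Ici 0) := by
    refine LipschitzOnWith.of_dist_le_mul fun s hs t ht => ?_
    rw [Real.coe_toNNReal _ hL, Real.dist_eq]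
    rcases le_total s t with h | h
    · rw [dist_comm, dist_eq_norm, abs_sub_comm, abs_of_nonneg (sub_nonneg.2 h)]
      exact ha s t hs h
    · rw [dist_eq_norm, abs_of_nonneg (sub_nonneg.2 h)]
      exact ha t s ht h
  refine ⟨⟨_, hlip⟩, ?_⟩
  rw [← restrict_Ioi_eq_restrict_Ici, ae_restrict_iff' measurableSet_Ioi]
  exact ae_of_all _ fun t ht =>
    (norm_deriv_le_of_lipschitzOn (Ici_mem_nhds (mem_Ioi.1 ht)) hlip).trans_eq (Real.coe_toNNReal _ hL)

theorem lipschitzWith_prodMk_right {X Y Z : Type*} [PseudoMetricSpace X] [PseudoMetricSpace Y]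
    [PseudoMetricSpace Z] {f : X × Y → Z} {K : ℝ≥0} (hK : LipschitzWith K f) (c : Y) :
    LipschitzWith K fun y => f (y, c) :=
  .of_dist_le_mul fun y y' => by simpa [Prod.dist_eq] using hK.dist_le_mul (y, c) (y', c)

/-- Picard–Lindelöf on `[0, T]` for a bounded, Lipschitz right-hand side. -/
theorem exists_solution_Icc {n m : ℕ}
    {f : EuclideanSpace ℝ (Fin n) × EuclideanSpace ℝ (Fin m) → EuclideanSpace ℝ (Fin n)}
    (hf : IsBoundedLipschitz f) {a : ℝ → EuclideanSpace ℝ (Fin m)}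
    (ha : ContinuousOn a (Ici 0)) (x₀ : EuclideanSpace ℝ (Fin n)) {T : ℝ} (hT : 0 ≤ T) :
    ∃ x : ℝ → EuclideanSpace ℝ (Fin n), x 0 = x₀ ∧
      ∀ t ∈ Icc 0 T, HasDerivWithinAt x (f (x t, a t)) (Icc 0 T) t := by
  obtain ⟨⟨C, hC⟩, K, hK⟩ := hf
  have hC0 : 0 ≤ C := (norm_nonneg _).trans (hC (x₀, a 0))
  -- Speed at most `C` keeps the solution within `C * T` of `x₀` up to time `T`, so a ball of that
  -- radius makes the local theorem cover all of `[0, T]`.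
  have hpl : IsPicardLindelof (fun t y => f (y, a t)) (⟨0, le_rfl, hT⟩ : Icc (0 : ℝ) T) x₀
      (C.toNNReal * T.toNNReal) 0 C.toNNReal K := by
    refine ⟨fun t _ => ?_, fun y _ => ?_, fun t _ y _ => ?_, ?_⟩
    · exact (lipschitzWith_prodMk_right hK (a t)).lipschitzOnWith
    · exact hK.continuous.comp_continuousOn
        (continuousOn_const.prodMk (ha.mono fun u hu => hu.1))
    · rw [Real.coe_toNNReal _ hC0]; exact hC _
    · simp [hT, hC0]
  exact hpl.exists_eq_forall_mem_Icc_hasDerivWithinAt₀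

/-- Existence of a global trajectory. -/
theorem exists_isTrajectory {n m : ℕ}
    {f : EuclideanSpace ℝ (Fin n) × EuclideanSpace ℝ (Fin m) → EuclideanSpace ℝ (Fin n)}
    (hf : IsBoundedLipschitz f) {a : ℝ → EuclideanSpace ℝ (Fin m)}
    (ha : ContinuousOn a (Ici 0)) (x₀ : EuclideanSpace ℝ (Fin n)) :
    ∃ x, IsTrajectory f a x₀ x := by
  obtain ⟨K, hK⟩ := hf.2
  choose X hX0 hX using fun N : ℕ => exists_solution_Icc hf ha x₀ (Nat.cast_nonneg N (α := ℝ))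
  have hder : ∀ {N : ℕ} {T : ℝ}, T ≤ N → ∀ t ∈ Ico 0 T,
      HasDerivWithinAt (X N) (f (X N t, a t)) (Ici t) t := fun {N T} hT t ht =>
    (hX N t ⟨ht.1, ht.2.le.trans hT⟩).mono_of_mem_nhdsWithin
      (mem_of_superset (Icc_mem_nhdsGE (ht.2.trans_le hT)) (Icc_subset_Icc_left ht.1))
  have hcont : ∀ {N : ℕ} {T : ℝ}, T ≤ N → ContinuousOn (X N) (Icc 0 T) := fun {N T} hT t ht =>
    (hX N t ⟨ht.1, ht.2.trans hT⟩).continuousWithinAt.mono (Icc_subset_Icc_right hT)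
  have huniq : ∀ (N N' : ℕ) (t : ℝ), 0 ≤ t → t ≤ N → t ≤ N' → X N t = X N' t := by
    intro N N' t h0 hN hN'
    refine ODE_solution_unique_of_mem_Icc_right (v := fun s y => f (y, a s))
      (s := fun _ => univ) (K := K) (fun s _ => ?_) (hcont hN) (hder hN) (fun _ _ => mem_univ _)
      (hcont hN') (hder hN') (fun _ _ => mem_univ _) ((hX0 N).trans (hX0 N').symm)
      (right_mem_Icc.2 h0)
    exact (lipschitzWith_prodMk_right hK (a s)).lipschitzOnWith
  -- Solutions on `[0, N]` agree by uniqueness and are glued. The `+ 1` puts `t` strictly below the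
  -- right endpoint, so near `t` the glued function is a single `X N`.
  set x : ℝ → EuclideanSpace ℝ (Fin n) := fun t => X (⌊t⌋₊ + 1) t with hx
  have hxX : ∀ (N : ℕ) (t : ℝ), 0 ≤ t → t ≤ N → x t = X N t := fun N t h0 hN =>
    huniq _ _ t h0 (by exact_mod_cast (Nat.lt_floor_add_one t).le) hN
  have hlt : ∀ t : ℝ, t < ((⌊t⌋₊ + 1 : ℕ) : ℝ) := fun t => by
    exact_mod_cast Nat.lt_floor_add_one t
  refine ⟨x, (hxX 0 0 le_rfl (by simp)).trans (hX0 0), fun t ht => ?_, fun t ht => ?_⟩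
  · have hmem : Icc (0 : ℝ) ((⌊t⌋₊ + 1 : ℕ) : ℝ) ∈ 𝓝[Ici 0] t := by
      rw [← Ici_inter_Iic]
      exact inter_mem self_mem_nhdsWithin (mem_nhdsWithin_of_mem_nhds (Iic_mem_nhds (hlt t)))
    have h1 : ContinuousWithinAt (X (⌊t⌋₊ + 1)) (Ici 0) t :=
      ((hX _ t ⟨ht, (hlt t).le⟩).continuousWithinAt).mono_of_mem_nhdsWithin hmem
    refine h1.congr_of_eventuallyEq ?_ rfl
    filter_upwards [hmem] with s hs using hxX _ s hs.1 hs.2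
  · have hmem := Icc_mem_nhds ht (hlt t)
    have h1 := (hX _ t ⟨ht.le, (hlt t).le⟩).hasDerivAt hmem
    refine h1.congr_of_eventuallyEq ?_
    filter_upwards [hmem] with s hs using hxX _ s hs.1 hs.2

/-- `ξ(z; h)` is the endpoint of some trajectory with constant action. -/
theorem exists_isTrajectory_xi {n m : ℕ}
    {f : EuclideanSpace ℝ (Fin n) × EuclideanSpace ℝ (Fin m) → EuclideanSpace ℝ (Fin n)}
    (hf : IsBoundedLipschitz f) (h : ℝ) (z : EuclideanSpace ℝ (Fin n) × EuclideanSpace ℝ (Fin m)) :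
    ∃ y, IsTrajectory f (fun _ => z.2) z.1 y ∧ y h = xi f h z :=
  ⟨_, Classical.epsilon_spec (exists_isTrajectory hf continuousOn_const z.1), rfl⟩

/-! ### The semi-discrete HJB equation: dynamic programming and contraction -/

theorem abs_ciSup_sub_ciSup_le {ι : Type*} [Nonempty ι] {u v : ι → ℝ} {S : ℝ}
    (hu : BddAbove (range u)) (hv : BddAbove (range v)) (h : ∀ i, |u i - v i| ≤ S) :
    |(⨆ i, u i) - ⨆ i, v i| ≤ S := by
  rw [abs_sub_le_iff]
  constructor
  · rw [sub_le_iff_le_add]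
    refine ciSup_le fun i => ?_
    linarith [le_ciSup hv i, (abs_le.1 (h i)).2]
  · rw [sub_le_iff_le_add]
    refine ciSup_le fun i => ?_
    linarith [le_ciSup hu i, (abs_le.1 (h i)).1]

section

variable {n m : ℕ}
  {f : EuclideanSpace ℝ (Fin n) × EuclideanSpace ℝ (Fin m) → EuclideanSpace ℝ (Fin n)}
  {r : EuclideanSpace ℝ (Fin n) × EuclideanSpace ℝ (Fin m) → ℝ} {γ L h C : ℝ}

/-- The recursion adds steps at the end, whereas dynamic programming removes the first one; this
shift reconciles the two. -/
theorem semiSeq_succ (b : ℕ → EuclideanSpace ℝ (Fin m))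
    (z : EuclideanSpace ℝ (Fin n) × EuclideanSpace ℝ (Fin m)) (k : ℕ) :
    semiSeq f h b z (k + 1) = semiSeq f h (fun i => b (i + 1)) (xi f h z, z.2 + h • b 0) k := by
  induction k with
  | zero => rfl
  | succ k ih => rw [semiSeq, ih]; rfl

theorem norm_reward_mul_pow_le (hC : ∀ z, ‖r z‖ ≤ C) (h1 : γ * h < 1)
    (b : ℕ → EuclideanSpace ℝ (Fin m))
    (z : EuclideanSpace ℝ (Fin n) × EuclideanSpace ℝ (Fin m)) (k : ℕ) :
    ‖r (semiSeq f h b z k) * (1 - γ * h) ^ k‖ ≤ C * (1 - γ * h) ^ k := by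
  rw [norm_mul, norm_pow, Real.norm_of_nonneg (sub_nonneg.2 h1.le)]
  exact mul_le_mul_of_nonneg_right (hC _) (pow_nonneg (sub_nonneg.2 h1.le) _)

theorem hasSum_const_mul_pow (h0 : 0 < γ * h) (h1 : γ * h < 1) :
    HasSum (fun k : ℕ => C * (1 - γ * h) ^ k) (C * (γ * h)⁻¹) := by
  have := (hasSum_geometric_of_lt_one (sub_nonneg.2 h1.le) (by linarith)).mul_left C
  rwa [sub_sub_cancel] at this

theorem summable_reward_mul_pow (hC : ∀ z, ‖r z‖ ≤ C) (h0 : 0 < γ * h) (h1 : γ * h < 1)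
    (b : ℕ → EuclideanSpace ℝ (Fin m))
    (z : EuclideanSpace ℝ (Fin n) × EuclideanSpace ℝ (Fin m)) :
    Summable fun k : ℕ => r (semiSeq f h b z k) * (1 - γ * h) ^ k :=
  .of_norm_bounded (hasSum_const_mul_pow h0 h1).summable (norm_reward_mul_pow_le hC h1 b z)

theorem abs_semiReturn_le (hC : ∀ z, ‖r z‖ ≤ C) (hh : 0 < h) (hγ : 0 < γ) (h1 : γ * h < 1)
    (b : ℕ → EuclideanSpace ℝ (Fin m))
    (z : EuclideanSpace ℝ (Fin n) × EuclideanSpace ℝ (Fin m)) :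
    |semiReturn f r γ h b z| ≤ C / γ := by
  have := tsum_of_norm_bounded (hasSum_const_mul_pow (mul_pos hγ hh) h1)
    (norm_reward_mul_pow_le (f := f) hC h1 b z)
  rw [semiReturn, abs_mul, abs_of_pos hh]
  calc h * _ ≤ h * (C * (γ * h)⁻¹) := mul_le_mul_of_nonneg_left this hh.le
    _ = C / γ := by field_simp

theorem semiReturn_eq (hC : ∀ z, ‖r z‖ ≤ C) (h0 : 0 < γ * h) (h1 : γ * h < 1)
    (b : ℕ → EuclideanSpace ℝ (Fin m))
    (z : EuclideanSpace ℝ (Fin n) × EuclideanSpace ℝ (Fin m)) :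
    semiReturn f r γ h b z = h * r z +
      (1 - γ * h) * semiReturn f r γ h (fun i => b (i + 1)) (xi f h z, z.2 + h • b 0) := by
  rw [semiReturn, (summable_reward_mul_pow hC h0 h1 b z).tsum_eq_zero_add, semiReturn]
  simp_rw [semiSeq_succ, pow_succ, ← mul_assoc]
  rw [tsum_mul_right]
  simp only [semiSeq, pow_zero]
  ring

theorem bddAbove_semiReturn (hC : ∀ z, ‖r z‖ ≤ C) (hh : 0 < h) (hγ : 0 < γ) (h1 : γ * h < 1)
    (z : EuclideanSpace ℝ (Fin n) × EuclideanSpace ℝ (Fin m)) :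
    BddAbove (range fun b : {b : ℕ → EuclideanSpace ℝ (Fin m) // ∀ k, ‖b k‖ ≤ L} =>
      semiReturn f r γ h b.1 z) := by
  refine ⟨C / γ, ?_⟩
  rintro _ ⟨b, rfl⟩
  exact (abs_le.1 (abs_semiReturn_le hC hh hγ h1 b.1 z)).2

theorem nonempty_controls (hL : 0 ≤ L) :
    Nonempty {b : ℕ → EuclideanSpace ℝ (Fin m) // ∀ k, ‖b k‖ ≤ L} :=
  ⟨⟨fun _ => 0, fun _ => by simpa using hL⟩⟩

theorem nonempty_actions (hL : 0 ≤ L) : Nonempty {b : EuclideanSpace ℝ (Fin m) // ‖b‖ ≤ L} :=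
  ⟨⟨0, by simpa using hL⟩⟩

theorem abs_semiQ_le (hC : ∀ z, ‖r z‖ ≤ C) (hh : 0 < h) (hγ : 0 < γ) (h1 : γ * h < 1)
    (hL : 0 ≤ L) (z : EuclideanSpace ℝ (Fin n) × EuclideanSpace ℝ (Fin m)) :
    |semiQ f r γ L h z| ≤ C / γ := by
  have := nonempty_controls (m := m) hL
  rw [abs_le]
  refine ⟨?_, ciSup_le fun b => (abs_le.1 (abs_semiReturn_le hC hh hγ h1 b.1 z)).2⟩
  obtain ⟨b⟩ := this
  exact (abs_le.1 (abs_semiReturn_le hC hh hγ h1 b.1 z)).1.trans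
    (le_ciSup (bddAbove_semiReturn hC hh hγ h1 z) b)

theorem bddAbove_of_abs_le {q : EuclideanSpace ℝ (Fin n) × EuclideanSpace ℝ (Fin m) → ℝ} {M : ℝ}
    (hq : ∀ z, |q z| ≤ M) {ι : Type*}
    (w : ι → EuclideanSpace ℝ (Fin n) × EuclideanSpace ℝ (Fin m)) :
    BddAbove (range fun i => q (w i)) := by
  refine ⟨M, ?_⟩
  rintro _ ⟨i, rfl⟩
  exact (abs_le.1 (hq _)).2

/-- A slope sequence is a first slope together with an arbitrary tail. The constraint is imposed
termwise, so the supremum over sequences is an iterated supremum. -/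
theorem solvesSemiHJB_semiQ (hC : ∀ z, ‖r z‖ ≤ C) (hh : 0 < h) (hγ : 0 < γ) (h1 : γ * h < 1)
    (hL : 0 ≤ L) : SolvesSemiHJB f r γ L h (semiQ f r γ L h) := by
  intro z
  have := nonempty_controls (m := m) hL
  have := nonempty_actions (m := m) hL
  have hpos : 0 < 1 - γ * h := sub_pos.2 h1
  have h0 : 0 < γ * h := mul_pos hγ hh
  have hbdd := bddAbove_of_abs_le (abs_semiQ_le (f := f) hC hh hγ h1 hL)
    fun b : {b : EuclideanSpace ℝ (Fin m) // ‖b‖ ≤ L} => (xi f h z, z.2 + h • b.1)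
  apply le_antisymm
  · refine ciSup_le fun b => ?_
    rw [semiReturn_eq hC h0 h1]
    gcongr
    refine le_trans ?_ (le_ciSup hbdd ⟨b.1 0, b.2 0⟩)
    exact le_ciSup (bddAbove_semiReturn hC hh hγ h1 _)
      (⟨fun i => b.1 (i + 1), fun i => b.2 (i + 1)⟩ :
        {b : ℕ → EuclideanSpace ℝ (Fin m) // ∀ k, ‖b k‖ ≤ L})
  -- The positive factor `1 - γ * h` is moved across so that the iterated supremum stands alone on
  -- the left and can be bounded termwise.
  · rw [← le_sub_iff_add_le', mul_comm, ← le_div_iff₀ hpos]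
    refine ciSup_le fun c => ciSup_le fun b => ?_
    rw [le_div_iff₀ hpos, le_sub_iff_add_le', mul_comm _ (1 - γ * h)]
    -- The competitor takes `c` as first slope and then follows `b`.
    have hb : ∀ k, ‖(Nat.casesOn k c.1 b.1 : EuclideanSpace ℝ (Fin m))‖ ≤ L := fun k => by
      cases k with
      | zero => exact c.2
      | succ k => exact b.2 k
    have key := semiReturn_eq (f := f) hC h0 h1
      (fun k => (Nat.casesOn k c.1 b.1 : EuclideanSpace ℝ (Fin m))) z
    refine key.symm.le.trans ?_
    exact le_ciSup (bddAbove_semiReturn hC hh hγ h1 z)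
      (⟨_, hb⟩ : {b : ℕ → EuclideanSpace ℝ (Fin m) // ∀ k, ‖b k‖ ≤ L})

/-- The supremum is nonexpansive, so the sup-distance `S` of two solutions satisfies `S ≤ (1 - γ *
h) * S`, which forces `S ≤ 0`. -/
theorem SolvesSemiHJB.unique {q₁ q₂ : EuclideanSpace ℝ (Fin n) × EuclideanSpace ℝ (Fin m) → ℝ}
    (h0 : 0 < γ * h) (h1 : γ * h < 1) (hL : 0 ≤ L)
    (hb₁ : IsBoundedFun q₁) (hb₂ : IsBoundedFun q₂)
    (hq₁ : SolvesSemiHJB f r γ L h q₁) (hq₂ : SolvesSemiHJB f r γ L h q₂) : q₁ = q₂ := by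
  obtain ⟨M₁, hM₁⟩ := hb₁
  obtain ⟨M₂, hM₂⟩ := hb₂
  have := nonempty_actions (m := m) hL
  have hpos : 0 ≤ 1 - γ * h := sub_nonneg.2 h1.le
  have hbdd : BddAbove (range fun z => |q₁ z - q₂ z|) := by
    refine ⟨M₁ + M₂, ?_⟩
    rintro _ ⟨z, rfl⟩
    exact (abs_sub _ _).trans (add_le_add (hM₁ z) (hM₂ z))
  set S := ⨆ z, |q₁ z - q₂ z| with hS
  have hle : ∀ z, |q₁ z - q₂ z| ≤ S := fun z => le_ciSup hbdd z
  have hcontr : S ≤ (1 - γ * h) * S := by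
    refine ciSup_le fun z => ?_
    rw [hq₁ z, hq₂ z, add_sub_add_left_eq_sub, ← mul_sub, abs_mul, abs_of_nonneg hpos]
    exact mul_le_mul_of_nonneg_left (abs_ciSup_sub_ciSup_le (bddAbove_of_abs_le hM₁ _)
      (bddAbove_of_abs_le hM₂ _) fun b => hle _) hpos
  have hS0 : S ≤ 0 := by nlinarith
  funext z
  exact sub_eq_zero.1 (abs_nonpos_iff.1 ((hle z).trans hS0))

end

/-! ### Error of the scheme along matched controls -/

section

variable {n m : ℕ}
  {f : EuclideanSpace ℝ (Fin n) × EuclideanSpace ℝ (Fin m) → EuclideanSpace ℝ (Fin n)}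
  {r : EuclideanSpace ℝ (Fin n) × EuclideanSpace ℝ (Fin m) → ℝ} {γ L h C M : ℝ} {K R : ℝ≥0}

theorem IsTrajectory.norm_sub_le {a : ℝ → EuclideanSpace ℝ (Fin m)} {x₀ : EuclideanSpace ℝ (Fin n)}
    {x : ℝ → EuclideanSpace ℝ (Fin n)} (hx : IsTrajectory f a x₀ x) (hM : ∀ z, ‖f z‖ ≤ M)
    {s t : ℝ} (hs : 0 ≤ s) (hst : s ≤ t) : ‖x t - x s‖ ≤ M * (t - s) :=
  norm_sub_le_of_hasDerivAt_Ioo hst (hx.2.1.mono fun _ hu => hs.trans hu.1)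
    (fun u hu => hx.2.2 u (hs.trans_lt hu.1)) fun _ _ => hM _

/-- Actions carry no error at grid times; only the states have to be compared. -/
theorem semiSeq_snd {a : ℝ → EuclideanSpace ℝ (Fin m)} {b : ℕ → EuclideanSpace ℝ (Fin m)}
    {z : EuclideanSpace ℝ (Fin n) × EuclideanSpace ℝ (Fin m)} (ha0 : a 0 = z.2)
    (hab : ∀ k : ℕ, a (h * (k + 1 : ℕ)) = a (h * k) + h • b k) (k : ℕ) :
    (semiSeq f h b z k).2 = a (h * k) := by
  induction k with
  | zero => simp [semiSeq, ha0]
  | succ k ih => rw [hab, ← ih]; rfl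

/-- Local error of one step of the scheme: the trajectory under a control `a` varying by at most
`L h` compared with the constant-action flow from a nearby point. -/
theorem norm_sub_xi_le (hf : IsBoundedLipschitz f) (hM : ∀ z, ‖f z‖ ≤ M)
    (hK : LipschitzWith K f) (hL : 0 ≤ L) (hh : 0 ≤ h) {a : ℝ → EuclideanSpace ℝ (Fin m)}
    (ha : ∀ s t, 0 ≤ s → s ≤ t → ‖a t - a s‖ ≤ L * (t - s)) {x₀ : EuclideanSpace ℝ (Fin n)}
    {x : ℝ → EuclideanSpace ℝ (Fin n)} (hx : IsTrajectory f a x₀ x) {τ : ℝ} (hτ : 0 ≤ τ)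
    (w : EuclideanSpace ℝ (Fin n) × EuclideanSpace ℝ (Fin m)) (hw : w.2 = a τ) :
    ‖x (τ + h) - xi f h w‖ ≤ (1 + h * K) * ‖x τ - w.1‖ + K * (2 * M + L) * h ^ 2 := by
  obtain ⟨y, hy, hyh⟩ := exists_isTrajectory_xi hf h w
  have hM0 : 0 ≤ M := (norm_nonneg _).trans (hM w)
  set e := ‖x τ - w.1‖ with he
  have hmaps : MapsTo (fun s => τ + s) (Icc 0 h) (Ici 0) := fun s hs => add_nonneg hτ hs.1
  -- Within one step each state moves by at most `M * h` and the action by at most `L * h`. The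
  -- arguments of `f` thus stay within `e + (2 * M + L) * h`.
  have key := norm_sub_le_of_hasDerivAt_Ioo (g := fun s => x (τ + s) - y s)
    (g' := fun s => f (x (τ + s), a (τ + s)) - f (y s, w.2)) (C := K * (e + (2 * M + L) * h)) hh
    ((hx.2.1.comp (by fun_prop) hmaps).sub (hy.2.1.mono fun s hs => hs.1))
    (fun s hs => ((hx.2.2 (τ + s) (by linarith [hs.1])).comp_const_add τ s).sub (hy.2.2 s hs.1))
    (fun s hs => by
      rw [← dist_eq_norm]
      refine (hK.dist_le_mul _ _).trans (mul_le_mul_of_nonneg_left ?_ K.2)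
      rw [Prod.dist_eq, dist_eq_norm, dist_eq_norm]
      have h1 := hx.norm_sub_le hM hτ (le_add_of_nonneg_right hs.1.le : τ ≤ τ + s)
      have h2 := hy.norm_sub_le hM le_rfl hs.1.le
      have h3 := ha _ _ hτ (le_add_of_nonneg_right hs.1.le : τ ≤ τ + s)
      rw [hy.1] at h2
      have h4 : M * s ≤ M * h := mul_le_mul_of_nonneg_left hs.2.le hM0
      have h5 : L * s ≤ L * h := mul_le_mul_of_nonneg_left hs.2.le hL
      have h6 : 0 ≤ M * h := mul_nonneg hM0 hh
      have h7 : 0 ≤ L * h := mul_nonneg hL hh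
      have h8 : 0 ≤ e := norm_nonneg _
      rw [add_sub_cancel_left] at h1 h3
      rw [sub_zero] at h2
      refine max_le ?_ ?_
      · have : x (τ + s) - y s = (x (τ + s) - x τ) + (x τ - w.1) - (y s - w.1) := by abel
        have := (norm_sub_le ((x (τ + s) - x τ) + (x τ - w.1)) (y s - w.1)).trans
          (add_le_add_left (norm_add_le _ _) _)
        rw [‹x (τ + s) - y s = _›]
        linarith
      · rw [hw]; linarith)
  simp only [add_zero, hyh, hy.1, sub_zero] at key
  have := (norm_le_insert' (x (τ + h) - xi f h w) (x τ - w.1)).trans (add_le_add_right key _)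
  refine this.trans_eq ?_
  rw [← he]; ring

/-- Discrete Gronwall: the bound solves `e (k + 1) = (1 + h * K) * e k + K * (2 * M + L) * h ^ 2`,
`e 0 = 0`, exactly. -/
theorem norm_sub_semiSeq_le (hf : IsBoundedLipschitz f) (hM : ∀ z, ‖f z‖ ≤ M)
    (hK : LipschitzWith K f) (hL : 0 ≤ L) (hh : 0 ≤ h) {a : ℝ → EuclideanSpace ℝ (Fin m)}
    (ha : ∀ s t, 0 ≤ s → s ≤ t → ‖a t - a s‖ ≤ L * (t - s))
    {z : EuclideanSpace ℝ (Fin n) × EuclideanSpace ℝ (Fin m)} (ha0 : a 0 = z.2)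
    {x : ℝ → EuclideanSpace ℝ (Fin n)} (hx : IsTrajectory f a z.1 x)
    {b : ℕ → EuclideanSpace ℝ (Fin m)}
    (hab : ∀ k : ℕ, a (h * (k + 1 : ℕ)) = a (h * k) + h • b k) (k : ℕ) :
    ‖x (h * k) - (semiSeq f h b z k).1‖ ≤ (2 * M + L) * h * ((1 + h * K) ^ k - 1) := by
  induction k with
  | zero => simp [semiSeq, hx.1]
  | succ k ih =>
    have := norm_sub_xi_le hf hM hK hL hh ha hx (mul_nonneg hh k.cast_nonneg)
      (semiSeq f h b z k) (semiSeq_snd ha0 hab k)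
    have h1 : h * (k + 1 : ℕ) = h * k + h := by push_cast; ring
    have h2 : (semiSeq f h b z (k + 1)).1 = xi f h (semiSeq f h b z k) := rfl
    rw [h1, h2]
    refine this.trans ?_
    refine (add_le_add_left (mul_le_mul_of_nonneg_left ih (by positivity)) _).trans_eq ?_
    ring

end

/-! ### Series as integrals, and the vanishing of the integrated defect -/

/-- Integral over `(0, ∞)` of a step function with steps of length `h`. -/
theorem integrableOn_and_integral_floor {c : ℕ → ℝ} (hc : Summable c) {h : ℝ} (hh : 0 < h) :
    IntegrableOn (fun t => c ⌊t / h⌋₊) (Ioi 0) ∧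
      ∫ t in Ioi (0 : ℝ), c ⌊t / h⌋₊ = h * ∑' k, c k := by
  set s : ℕ → Set ℝ := fun k => Ico (h * k) (h * (k + 1)) with hs
  have hmem : ∀ {k : ℕ} {t : ℝ}, t ∈ s k ↔ 0 ≤ t ∧ ⌊t / h⌋₊ = k := by
    intro k t
    constructor
    · rintro ⟨h1, h2⟩
      have h0 : 0 ≤ t := (mul_nonneg hh.le k.cast_nonneg).trans h1
      refine ⟨h0, (Nat.floor_eq_iff (div_nonneg h0 hh.le)).2 ⟨?_, ?_⟩⟩
      · rwa [le_div_iff₀' hh]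
      · rwa [div_lt_iff₀' hh]
    · rintro ⟨h0, hk⟩
      rw [Nat.floor_eq_iff (div_nonneg h0 hh.le), le_div_iff₀' hh, div_lt_iff₀' hh] at hk
      exact hk
  have hU : (⋃ k, s k) = Ici 0 := by
    ext t
    simp [hmem]
  have hm : ∀ k, MeasurableSet (s k) := fun k => measurableSet_Ico
  have hd : Pairwise (Function.onFun Disjoint s) := fun i j hij =>
    Set.disjoint_left.2 fun t hi hj => hij ((hmem.1 hi).2.symm.trans (hmem.1 hj).2)
  have hvol : ∀ k, (volume (s k)) = ENNReal.ofReal h := fun k => by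
    rw [hs, Real.volume_Ico]; congr 1; ring
  -- Stated for arbitrary `d` because it is applied both to `c` and to the norms `‖c k‖`.
  have hint : ∀ (d : ℕ → ℝ) k, ∫ t in s k, d ⌊t / h⌋₊ = h * d k := fun d k => by
    rw [setIntegral_congr_fun (hm k) (g := fun _ => d k) fun t ht => by
      simp only [(hmem.1 ht).2]]
    simp [measureReal_def, hvol, hh.le]
  have hon : ∀ k, IntegrableOn (fun t => c ⌊t / h⌋₊) (s k) := fun k =>
    (integrableOn_const (C := c k) (by rw [hvol]; simp) (by simp)).congr_fun
      (fun t ht => by simp only [(hmem.1 ht).2]) (hm k)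
  have hI : IntegrableOn (fun t => c ⌊t / h⌋₊) (⋃ k, s k) := by
    refine integrableOn_iUnion_of_summable_integral_norm hon ?_
    simp_rw [hint (fun k => ‖c k‖)]
    exact hc.norm.mul_left h
  have hS := integral_iUnion hm hd hI
  rw [hU, integral_Ici_eq_integral_Ioi] at hS
  rw [hU] at hI
  refine ⟨hI.mono_set Ioi_subset_Ici_self, ?_⟩
  rw [hS, ← tsum_mul_left]
  exact tsum_congr (hint c)

/-- Pointwise error bound between the continuous and the semi-discrete discounted reward. -/
noncomputable def defect (γ C A κ h t : ℝ) : ℝ :=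
  Real.exp (-γ * t) * min (2 * C) (A * h * Real.exp (κ * t)) +
    C * |Real.exp (-γ * t) - (1 - γ * h) ^ ⌊t / h⌋₊|

theorem mul_floor_div_mem {h t : ℝ} (hh : 0 < h) (ht : 0 ≤ t) :
    h * ⌊t / h⌋₊ ∈ Icc (t - h) t := by
  have h1 := Nat.floor_le (div_nonneg ht hh.le)
  have h2 := Nat.lt_floor_add_one (t / h)
  rw [le_div_iff₀' hh] at h1
  rw [div_lt_iff₀' hh] at h2
  exact ⟨by linarith, h1⟩

/-- The grid time lags behind `t` by at most `h`; since `γ * h < 1`, this lag costs at most a factor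
`e`. -/
theorem one_sub_pow_floor_le {γ h t : ℝ} (hγ : 0 < γ) (hh : 0 < h) (h1 : γ * h < 1) (ht : 0 ≤ t) :
    (1 - γ * h) ^ ⌊t / h⌋₊ ≤ Real.exp 1 * Real.exp (-γ * t) := by
  have h2 : 1 - γ * h ≤ Real.exp (-(γ * h)) := by linarith [Real.add_one_le_exp (-(γ * h))]
  refine (pow_le_pow_left₀ (sub_nonneg.2 h1.le) h2 _).trans ?_
  rw [← Real.exp_nat_mul, ← Real.exp_add, Real.exp_le_exp]
  have := mul_le_mul_of_nonneg_left (mul_floor_div_mem hh ht).1 hγ.le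
  linarith

/-- The logarithm is `(h * ⌊t / h⌋₊) * (log (1 - γ * h) / h)`. The first factor tends to `t`, and
the second to the derivative `-γ` of `log (1 - γ * h)` at `0`. -/
theorem tendsto_one_sub_pow_floor (γ : ℝ) {t : ℝ} (ht : 0 ≤ t) :
    Tendsto (fun h : ℝ => (1 - γ * h) ^ ⌊t / h⌋₊) (𝓝[>] 0) (𝓝 (Real.exp (-γ * t))) := by
  have hid : Tendsto (fun h : ℝ => h) (𝓝[>] 0) (𝓝 0) := nhdsWithin_le_nhds
  have h1 : Tendsto (fun h : ℝ => h * ⌊t / h⌋₊) (𝓝[>] 0) (𝓝 t) := by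
    have hl : Tendsto (fun h : ℝ => t - h) (𝓝[>] 0) (𝓝 t) := by
      simpa using hid.const_sub t
    refine tendsto_of_tendsto_of_tendsto_of_le_of_le' hl tendsto_const_nhds ?_ ?_
    · filter_upwards [self_mem_nhdsWithin] with h hh using (mul_floor_div_mem hh ht).1
    · filter_upwards [self_mem_nhdsWithin] with h hh using (mul_floor_div_mem hh ht).2
  have h2 : Tendsto (fun h : ℝ => h⁻¹ * Real.log (1 - γ * h)) (𝓝[>] 0) (𝓝 (-γ)) := by
    have hd : HasDerivAt (fun h : ℝ => Real.log (1 - γ * h)) (-γ) 0 := by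
      have h3 : HasDerivAt (fun h : ℝ => 1 - γ * h) (-γ) 0 := by
        simpa using ((hasDerivAt_id (0 : ℝ)).const_mul γ).const_sub 1
      simpa using h3.log (by simp)
    have := hd.tendsto_slope_zero_right
    simpa using this
  have h3 := (Real.continuous_exp.tendsto _).comp (h1.mul h2)
  rw [mul_comm t] at h3
  refine h3.congr' ?_
  have hpos : ∀ᶠ h : ℝ in 𝓝[>] 0, 0 < 1 - γ * h := by
    have : Tendsto (fun h : ℝ => 1 - γ * h) (𝓝[>] 0) (𝓝 1) := by
      simpa using (hid.const_mul γ).const_sub 1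
    exact this.eventually (lt_mem_nhds one_pos)
  filter_upwards [hpos, self_mem_nhdsWithin] with h hp hh
  have hh : h ≠ 0 := ne_of_gt hh
  rw [Function.comp_apply]
  conv_rhs => rw [← Real.exp_log hp, ← Real.exp_nat_mul]
  congr 1
  field_simp

theorem defect_nonneg {γ C A κ h : ℝ} (hC : 0 ≤ C) (hA : 0 ≤ A) (hh : 0 < h) (t : ℝ) :
    0 ≤ defect γ C A κ h t := by
  unfold defect; positivity

/-- This majorant is integrable and free of `h`, as dominated convergence requires; the cap `2 * C`
removes the factor `exp (κ * t)`. -/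
theorem defect_le {γ C A κ h t : ℝ} (hγ : 0 < γ) (hC : 0 ≤ C) (hh : 0 < h) (h1 : γ * h < 1)
    (ht : 0 ≤ t) :
    defect γ C A κ h t ≤ Real.exp (-γ * t) * (2 * C + C * (1 + Real.exp 1)) := by
  have h2 := one_sub_pow_floor_le hγ hh h1 ht
  have h3 : 0 ≤ (1 - γ * h) ^ ⌊t / h⌋₊ := pow_nonneg (sub_nonneg.2 h1.le) _
  have h4 := Real.exp_pos (-γ * t)
  have h5 : |Real.exp (-γ * t) - (1 - γ * h) ^ ⌊t / h⌋₊| ≤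
      Real.exp (-γ * t) * (1 + Real.exp 1) := by
    have := mul_pos (Real.exp_pos 1) h4
    rw [abs_le]; constructor <;> linarith
  have h6 := mul_le_mul_of_nonneg_left (min_le_left (2 * C) (A * h * Real.exp (κ * t))) h4.le
  have h7 := mul_le_mul_of_nonneg_left h5 hC
  unfold defect
  linarith

theorem measurable_defect (γ C A κ h : ℝ) : Measurable (defect γ C A κ h) := by
  have : Measurable fun t : ℝ => (1 - γ * h) ^ ⌊t / h⌋₊ :=
    (measurable_of_countable fun k : ℕ => (1 - γ * h) ^ k).comp
      (Nat.measurable_floor.comp (measurable_id.div_const h))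
  unfold defect
  fun_prop

theorem integrableOn_exp_mul_const {γ : ℝ} (hγ : 0 < γ) (B : ℝ) :
    IntegrableOn (fun t => Real.exp (-γ * t) * B) (Ioi 0) :=
  (exp_neg_integrableOn_Ioi 0 hγ).mul_const B

theorem integrableOn_defect {γ C A κ h : ℝ} (hγ : 0 < γ) (hC : 0 ≤ C) (hA : 0 ≤ A) (hh : 0 < h)
    (h1 : γ * h < 1) : IntegrableOn (defect γ C A κ h) (Ioi 0) := by
  refine (integrableOn_exp_mul_const hγ (2 * C + C * (1 + Real.exp 1))).mono'
    (measurable_defect γ C A κ h).aestronglyMeasurable ?_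
  refine (ae_restrict_iff' measurableSet_Ioi).2 (ae_of_all _ fun t ht => ?_)
  rw [Real.norm_of_nonneg (defect_nonneg hC hA hh t)]
  exact defect_le hγ hC hh h1 (mem_Ioi.1 ht).le

theorem eventually_step {γ : ℝ} (hγ : 0 < γ) : ∀ᶠ h : ℝ in 𝓝[>] 0, 0 < h ∧ γ * h < 1 := by
  filter_upwards [Ioo_mem_nhdsGT (one_div_pos.2 hγ)] with h hh
  exact ⟨hh.1, by rw [mul_comm]; exact (lt_div_iff₀ hγ).1 hh.2⟩

theorem tendsto_integral_defect {γ C A κ : ℝ} (hγ : 0 < γ) (hC : 0 ≤ C) (hA : 0 ≤ A) :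
    Tendsto (fun h => ∫ t in Ioi 0, defect γ C A κ h t) (𝓝[>] 0) (𝓝 0) := by
  have := tendsto_integral_filter_of_dominated_convergence (μ := volume.restrict (Ioi 0))
    (l := 𝓝[>] (0 : ℝ)) (F := fun h t => defect γ C A κ h t) (f := fun _ => (0 : ℝ))
    (fun t => Real.exp (-γ * t) * (2 * C + C * (1 + Real.exp 1)))
    (Eventually.of_forall fun h => (measurable_defect γ C A κ h).aestronglyMeasurable) ?_
    (integrableOn_exp_mul_const hγ _) ?_
  · simpa using this
  · filter_upwards [eventually_step hγ] with h hh
    refine (ae_restrict_iff' measurableSet_Ioi).2 (ae_of_all _ fun t ht => ?_)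
    rw [Real.norm_of_nonneg (defect_nonneg hC hA hh.1 t)]
    exact defect_le hγ hC hh.1 hh.2 (mem_Ioi.1 ht).le
  · refine (ae_restrict_iff' measurableSet_Ioi).2 (ae_of_all _ fun t ht => ?_)
    have hid : Tendsto (fun h : ℝ => h) (𝓝[>] 0) (𝓝 0) := nhdsWithin_le_nhds
    have h1 : Tendsto (fun h => Real.exp (-γ * t) * min (2 * C) (A * h * Real.exp (κ * t)))
        (𝓝[>] 0) (𝓝 (Real.exp (-γ * t) * min (2 * C) (A * 0 * Real.exp (κ * t)))) :=
      (tendsto_const_nhds.min ((hid.const_mul A).mul_const _)).const_mul _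
    have h2 := (((tendsto_one_sub_pow_floor γ (mem_Ioi.1 ht).le).const_sub
      (Real.exp (-γ * t))).abs).const_mul C
    have := h1.add h2
    simpa [hC, defect] using this

/-! ### Comparison of the returns for one matched pair of controls -/

section

variable {n m : ℕ}
  {f : EuclideanSpace ℝ (Fin n) × EuclideanSpace ℝ (Fin m) → EuclideanSpace ℝ (Fin n)}
  {r : EuclideanSpace ℝ (Fin n) × EuclideanSpace ℝ (Fin m) → ℝ} {γ L h C M : ℝ} {K R : ℝ≥0}

theorem integrableOn_discounted_reward (hγ : 0 < γ) (hC : ∀ z, ‖r z‖ ≤ C) (hr : Continuous r)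
    {a : ℝ → EuclideanSpace ℝ (Fin m)} (ha : ContinuousOn a (Ici 0))
    {x : ℝ → EuclideanSpace ℝ (Fin n)} (hx : ContinuousOn x (Ici 0)) :
    IntegrableOn (fun t => Real.exp (-γ * t) * r (x t, a t)) (Ioi 0) := by
  have hcont : ContinuousOn (fun t => Real.exp (-γ * t) * r (x t, a t)) (Ioi 0) :=
    ((by fun_prop : Continuous fun t : ℝ => Real.exp (-γ * t)).continuousOn.mul
      (hr.comp_continuousOn (hx.prodMk ha))).mono Ioi_subset_Ici_self
  refine (integrableOn_exp_mul_const hγ C).mono'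
    (hcont.aestronglyMeasurable measurableSet_Ioi) (ae_of_all _ fun t => ?_)
  rw [norm_mul, Real.norm_of_nonneg (Real.exp_pos _).le]
  exact mul_le_mul_of_nonneg_left (hC _) (Real.exp_pos _).le

theorem abs_integral_discounted_reward_le (hγ : 0 < γ) (hC : ∀ z, ‖r z‖ ≤ C)
    (a : ℝ → EuclideanSpace ℝ (Fin m)) (x : ℝ → EuclideanSpace ℝ (Fin n)) :
    |∫ t in Ioi (0 : ℝ), Real.exp (-γ * t) * r (x t, a t)| ≤
      ∫ t in Ioi (0 : ℝ), Real.exp (-γ * t) * C := by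
  rw [← Real.norm_eq_abs]
  refine norm_integral_le_of_norm_le (integrableOn_exp_mul_const hγ C) (ae_of_all _ fun t => ?_)
  rw [norm_mul, Real.norm_of_nonneg (Real.exp_pos _).le]
  exact mul_le_mul_of_nonneg_left (hC _) (Real.exp_pos _).le

theorem continuousOn_of_norm_sub_le {a : ℝ → EuclideanSpace ℝ (Fin m)} (hL : 0 ≤ L)
    (ha : ∀ s t, 0 ≤ s → s ≤ t → ‖a t - a s‖ ≤ L * (t - s)) : ContinuousOn a (Ici 0) := by
  obtain ⟨⟨_, hlip⟩, _⟩ := isAdmissible_of_norm_sub_le hL ha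
  exact hlip.continuousOn

/-- The continuous and the semi-discrete return along matching controls differ by at most the
integrated defect, uniformly in the initial point and in the control. -/
theorem abs_integral_sub_semiReturn_le (hγ : 0 < γ) (hf : IsBoundedLipschitz f)
    (hM : ∀ z, ‖f z‖ ≤ M) (hK : LipschitzWith K f) (hC : ∀ z, ‖r z‖ ≤ C) (hR : LipschitzWith R r)
    (hL : 0 ≤ L) (hh : 0 < h) (h1 : γ * h < 1) {a : ℝ → EuclideanSpace ℝ (Fin m)}
    (ha : ∀ s t, 0 ≤ s → s ≤ t → ‖a t - a s‖ ≤ L * (t - s))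
    {z : EuclideanSpace ℝ (Fin n) × EuclideanSpace ℝ (Fin m)} (ha0 : a 0 = z.2)
    {x : ℝ → EuclideanSpace ℝ (Fin n)} (hx : IsTrajectory f a z.1 x)
    {b : ℕ → EuclideanSpace ℝ (Fin m)}
    (hab : ∀ k : ℕ, a (h * (k + 1 : ℕ)) = a (h * k) + h • b k) :
    |(∫ t in Ioi (0 : ℝ), Real.exp (-γ * t) * r (x t, a t)) - semiReturn f r γ h b z| ≤
      ∫ t in Ioi 0, defect γ C (R * (3 * M + 2 * L)) K h t := by
  have hM0 : 0 ≤ M := (norm_nonneg _).trans (hM z)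
  have hC0 : 0 ≤ C := (norm_nonneg _).trans (hC z)
  obtain ⟨hI, hE⟩ := integrableOn_and_integral_floor
    (summable_reward_mul_pow (f := f) hC (mul_pos hγ hh) h1 b z) hh
  rw [semiReturn, ← hE, ← integral_sub (integrableOn_discounted_reward hγ hC hR.continuous
    (continuousOn_of_norm_sub_le hL ha) hx.2.1) hI]
  rw [← Real.norm_eq_abs]
  refine norm_integral_le_of_norm_le
    (integrableOn_defect hγ hC0 (by positivity) hh h1)
    ((ae_restrict_iff' measurableSet_Ioi).2 (ae_of_all _ fun t ht => ?_))
  have ht : 0 ≤ t := (mem_Ioi.1 ht).le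
  set k := ⌊t / h⌋₊ with hk
  obtain ⟨hk1, hk2⟩ := mul_floor_div_mem hh ht
  rw [← hk] at hk1 hk2
  have hk0 : 0 ≤ h * k := mul_nonneg hh.le k.cast_nonneg
  set w := semiSeq f h b z k with hw
  have hexp1 : 1 ≤ Real.exp (K * t) := Real.one_le_exp (mul_nonneg K.2 ht)
  have hpow : (1 + h * K) ^ k ≤ Real.exp (K * t) := by
    have h2 : 1 + h * K ≤ Real.exp (h * K) := by linarith [Real.add_one_le_exp (h * (K : ℝ))]
    refine (pow_le_pow_left₀ (by positivity) h2 _).trans ?_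
    rw [← Real.exp_nat_mul, Real.exp_le_exp]
    have := mul_le_mul_of_nonneg_left hk2 K.2
    calc (k : ℝ) * (h * K) = K * (h * k) := by ring
      _ ≤ K * t := this
  have hMh : 0 ≤ M * h := by positivity
  have hLh : 0 ≤ L * h := by positivity
  -- The state error is the grid error `(2 * M + L) * h` times the growth factor, plus the motion `M
  -- * h` since the last grid time. The action error is at most `L * h`, and the sum of the two
  -- dominates the maximum in the product metric.
  have hlip : |r (x t, a t) - r w| ≤ R * (3 * M + 2 * L) * h * Real.exp (K * t) := by
    rw [← Real.dist_eq]
    refine (hR.dist_le_mul _ _).trans ?_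
    rw [mul_assoc, mul_assoc]
    refine mul_le_mul_of_nonneg_left ?_ R.2
    rw [Prod.dist_eq, dist_eq_norm, dist_eq_norm]
    have e1 := hx.norm_sub_le hM hk0 hk2
    have e2 := norm_sub_semiSeq_le hf hM hK hL hh.le ha ha0 hx hab k
    have e3 := ha _ _ hk0 hk2
    have e4 : M * (t - h * k) ≤ M * h := mul_le_mul_of_nonneg_left (by linarith) hM0
    have e5 : L * (t - h * k) ≤ L * h := mul_le_mul_of_nonneg_left (by linarith) hL
    have e6 : (2 * M + L) * h * ((1 + h * K) ^ k - 1) ≤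
        (2 * M + L) * h * Real.exp (K * t) :=
      mul_le_mul_of_nonneg_left (by linarith) (by positivity)
    have e7 : M * h ≤ M * h * Real.exp (K * t) := le_mul_of_one_le_right hMh hexp1
    have e8 : L * h ≤ L * h * Real.exp (K * t) := le_mul_of_one_le_right hLh hexp1
    have e9 : 0 ≤ M * h * Real.exp (K * t) := by positivity
    refine max_le ?_ ?_
    · have := norm_sub_le_norm_sub_add_norm_sub (x t) (x (h * k)) w.1
      simp only
      linarith
    · rw [hw, semiSeq_snd ha0 hab]
      simp only
      linarith
  have hbdd : |r (x t, a t) - r w| ≤ 2 * C := by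
    have := (abs_sub (r (x t, a t)) (r w)).trans (add_le_add (hC _) (hC _))
    linarith
  -- The reward error is weighted by the exact discount, and the discount error by a bounded reward;
  -- these are the two terms of `defect`.
  have hsplit : Real.exp (-γ * t) * r (x t, a t) - r w * (1 - γ * h) ^ k =
      Real.exp (-γ * t) * (r (x t, a t) - r w) +
        r w * (Real.exp (-γ * t) - (1 - γ * h) ^ k) := by ring
  rw [hsplit, defect]
  refine (norm_add_le _ _).trans (add_le_add ?_ ?_)
  · rw [norm_mul, Real.norm_of_nonneg (Real.exp_pos _).le]
    exact mul_le_mul_of_nonneg_left (le_min hbdd hlip) (Real.exp_pos _).le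
  · rw [norm_mul]
    exact mul_le_mul_of_nonneg_right (hC _) (norm_nonneg _)

end

/-! ### Transfer between slope sequences and controls, and the optimal values -/

/-- Every sequence of slopes bounded by `L` is interpolated by an `L`-Lipschitz control. -/
theorem exists_control_of_slopes {m : ℕ} {L h : ℝ} (hh : 0 < h) (a₀ : EuclideanSpace ℝ (Fin m))
    {b : ℕ → EuclideanSpace ℝ (Fin m)} (hb : ∀ k, ‖b k‖ ≤ L) :
    ∃ a : ℝ → EuclideanSpace ℝ (Fin m), a 0 = a₀ ∧
      (∀ s t, 0 ≤ s → s ≤ t → ‖a t - a s‖ ≤ L * (t - s)) ∧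
      ∀ k : ℕ, a (h * (k + 1 : ℕ)) = a (h * k) + h • b k := by
  set g : ℝ → EuclideanSpace ℝ (Fin m) := fun s => b ⌊s / h⌋₊ with hg
  have hmeas : Measurable g := (measurable_of_countable b).comp
    (Nat.measurable_floor.comp (measurable_id.div_const h))
  have hint : ∀ s t, IntervalIntegrable g volume s t := fun s t =>
    (intervalIntegrable_const (c := L)).mono_fun hmeas.aestronglyMeasurable
      (ae_of_all _ fun u => (hb _).trans (le_abs_self L))
  have hsub : ∀ s t : ℝ, (a₀ + ∫ u in (0 : ℝ)..t, g u) - (a₀ + ∫ u in (0 : ℝ)..s, g u) =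
      ∫ u in s..t, g u := fun s t => by
    rw [add_sub_add_left_eq_sub, intervalIntegral.integral_interval_sub_left (hint _ _) (hint _ _)]
  refine ⟨fun t => a₀ + ∫ u in (0 : ℝ)..t, g u, by simp, fun s t _ hst => ?_, fun k => ?_⟩
  · simp only [hsub]
    have := intervalIntegral.norm_integral_le_of_norm_le_const (f := g) (C := L) (a := s) (b := t)
      fun u _ => hb _
    rwa [abs_of_nonneg (sub_nonneg.2 hst)] at this
  · rw [← sub_eq_iff_eq_add', hsub]
    have hle : h * k ≤ h * (k + 1 : ℕ) := by gcongr; simp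
    -- The interval is closed on the left and open on the right because `⌊u / h⌋₊ = k` holds at `h *
    -- k` but fails at `h * (k + 1)`.
    rw [intervalIntegral.integral_of_le hle, ← integral_Ico_eq_integral_Ioc,
      setIntegral_congr_fun measurableSet_Ico (g := fun _ => b k)]
    · have : h * (k + 1 : ℕ) - h * k = h := by push_cast; ring
      simp [this, hh.le, -Nat.cast_add]
    · intro u hu
      have hu0 : 0 ≤ u := (mul_nonneg hh.le k.cast_nonneg).trans hu.1
      have : ⌊u / h⌋₊ = k := by
        rw [Nat.floor_eq_iff (div_nonneg hu0 hh.le), le_div_iff₀' hh, div_lt_iff₀' hh]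
        exact_mod_cast hu
      simp only [hg, this]

section

variable {n m : ℕ}
  {f : EuclideanSpace ℝ (Fin n) × EuclideanSpace ℝ (Fin m) → EuclideanSpace ℝ (Fin n)}
  {r : EuclideanSpace ℝ (Fin n) × EuclideanSpace ℝ (Fin m) → ℝ} {γ L h C M : ℝ} {K R : ℝ≥0}

/-- The semi-discrete and the continuous optimal values differ by at most the integrated defect. -/
theorem abs_qFun_sub_semiQ_le (hγ : 0 < γ) (hf : IsBoundedLipschitz f)
    (hM : ∀ z, ‖f z‖ ≤ M) (hK : LipschitzWith K f) (hC : ∀ z, ‖r z‖ ≤ C) (hR : LipschitzWith R r)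
    (hL : 0 ≤ L) (hh : 0 < h) (h1 : γ * h < 1)
    (z : EuclideanSpace ℝ (Fin n) × EuclideanSpace ℝ (Fin m)) :
    |qFun f r γ L z - semiQ f r γ L h z| ≤
      ∫ t in Ioi 0, defect γ C (R * (3 * M + 2 * L)) K h t := by
  have := nonempty_controls (m := m) hL
  set δ := ∫ t in Ioi 0, defect γ C (R * (3 * M + 2 * L)) K h t
  have hbdd : BddAbove {J : ℝ | ∃ (a : ℝ → EuclideanSpace ℝ (Fin m))
      (x : ℝ → EuclideanSpace ℝ (Fin n)),
      IsAdmissible L a ∧ a 0 = z.2 ∧ IsTrajectory f a z.1 x ∧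
        J = ∫ t in Set.Ioi (0 : ℝ), Real.exp (-γ * t) * r (x t, a t)} := by
    refine ⟨∫ t in Ioi (0 : ℝ), Real.exp (-γ * t) * C, ?_⟩
    rintro _ ⟨a, x, -, -, -, rfl⟩
    exact (abs_le.1 (abs_integral_discounted_reward_le hγ hC a x)).2
  have hforward : ∀ b : ℕ → EuclideanSpace ℝ (Fin m), (∀ k, ‖b k‖ ≤ L) →
      ∃ (a : ℝ → EuclideanSpace ℝ (Fin m)) (x : ℝ → EuclideanSpace ℝ (Fin n)),
        IsAdmissible L a ∧ a 0 = z.2 ∧ IsTrajectory f a z.1 x ∧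
        |(∫ t in Ioi (0 : ℝ), Real.exp (-γ * t) * r (x t, a t)) - semiReturn f r γ h b z| ≤ δ := by
    intro b hb
    obtain ⟨a, ha0, ha, hab⟩ := exists_control_of_slopes hh z.2 hb
    obtain ⟨x, hx⟩ := exists_isTrajectory hf (continuousOn_of_norm_sub_le hL ha) z.1
    exact ⟨a, x, isAdmissible_of_norm_sub_le hL ha, ha0, hx,
      abs_integral_sub_semiReturn_le hγ hf hM hK hC hR hL hh h1 ha ha0 hx hab⟩
  rw [abs_sub_le_iff, sub_le_iff_le_add, sub_le_iff_le_add]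
  constructor
  · refine csSup_le ?_ ?_
    · obtain ⟨a, x, ha, ha0, hx, -⟩ := hforward (fun _ => 0) fun _ => by simpa using hL
      exact ⟨_, a, x, ha, ha0, hx, rfl⟩
    · rintro _ ⟨a, x, ha, ha0, hx, rfl⟩
      have hlip : ∀ s t, 0 ≤ s → s ≤ t → ‖a t - a s‖ ≤ L * (t - s) := fun s t hs hst =>
        ha.norm_sub_le hL hs hst
      -- Difference quotients of the control on the grid; the Lipschitz bound makes them admissible
      -- slopes.
      set b : ℕ → EuclideanSpace ℝ (Fin m) := fun k =>
        h⁻¹ • (a (h * (k + 1 : ℕ)) - a (h * k)) with hb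
      have hbL : ∀ k, ‖b k‖ ≤ L := fun k => by
        have hle : h * k ≤ h * (k + 1 : ℕ) := by gcongr; simp
        have := hlip _ _ (mul_nonneg hh.le k.cast_nonneg) hle
        have hstep : h * (k + 1 : ℕ) - h * k = h := by push_cast; ring
        rw [hstep] at this
        rw [hb, norm_smul, norm_inv, Real.norm_of_nonneg hh.le, inv_mul_le_iff₀ hh, mul_comm h L]
        exact this
      have key := abs_integral_sub_semiReturn_le hγ hf hM hK hC hR hL hh h1 hlip ha0 hx (b := b)
        fun k => by simp only [hb, smul_inv_smul₀ hh.ne', add_sub_cancel]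
      have hle := le_ciSup (bddAbove_semiReturn (f := f) hC hh hγ h1 z)
        (⟨b, hbL⟩ : {b : ℕ → EuclideanSpace ℝ (Fin m) // ∀ k, ‖b k‖ ≤ L})
      have := (abs_le.1 key).2
      unfold semiQ
      linarith
  · refine ciSup_le fun b => ?_
    obtain ⟨a, x, ha, ha0, hx, hδ⟩ := hforward b.1 b.2
    have hle := le_csSup hbdd ⟨a, x, ha, ha0, hx, rfl⟩
    have := (abs_le.1 hδ).1
    unfold qFun
    linarith

end

end HJQ

theorem proposition3 (n m : ℕ)
    (f : EuclideanSpace ℝ (Fin n) × EuclideanSpace ℝ (Fin m) → EuclideanSpace ℝ (Fin n))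
    (r : EuclideanSpace ℝ (Fin n) × EuclideanSpace ℝ (Fin m) → ℝ)
    (γ L : ℝ) (hγ : 0 < γ) (hL : 0 ≤ L)
    (hf : HJQ.IsBoundedLipschitz f) (hr : HJQ.IsBoundedLipschitz r) :
    (∀ h : ℝ, 0 < h → h < 1 / γ →
      HJQ.IsBoundedFun (HJQ.semiQ f r γ L h) ∧
      HJQ.SolvesSemiHJB f r γ L h (HJQ.semiQ f r γ L h) ∧
      ∀ q : EuclideanSpace ℝ (Fin n) × EuclideanSpace ℝ (Fin m) → ℝ,
        HJQ.IsBoundedFun q → HJQ.SolvesSemiHJB f r γ L h q → q = HJQ.semiQ f r γ L h) ∧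
    ∀ K : Set (EuclideanSpace ℝ (Fin n) × EuclideanSpace ℝ (Fin m)), IsCompact K →
      TendstoUniformlyOn (fun h : ℝ => HJQ.semiQ f r γ L h) (HJQ.qFun f r γ L)
        (nhdsWithin 0 (Set.Ioi 0)) K := by
  obtain ⟨M, hM⟩ := hf.1
  obtain ⟨κ, hκ⟩ := hf.2
  obtain ⟨⟨C, hC⟩, R, hR⟩ := hr
  refine ⟨fun h hh hlt => ?_, fun K _ => ?_⟩
  · have h1 : γ * h < 1 := by rw [mul_comm]; exact (lt_div_iff₀ hγ).1 hlt
    have hb : HJQ.IsBoundedFun (HJQ.semiQ f r γ L h) :=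
      ⟨C / γ, HJQ.abs_semiQ_le hC hh hγ h1 hL⟩
    have hs := HJQ.solvesSemiHJB_semiQ (f := f) hC hh hγ h1 hL
    exact ⟨hb, hs, fun q hqb hqs => hqs.unique (mul_pos hγ hh) h1 hL hqb hb hs⟩
  · have hM0 : 0 ≤ M := (norm_nonneg _).trans (hM 0)
    have hC0 : 0 ≤ C := (norm_nonneg _).trans (hC 0)
    rw [Metric.tendstoUniformlyOn_iff]
    intro ε hε
    have hlim := HJQ.tendsto_integral_defect (γ := γ) (C := C) (A := R * (3 * M + 2 * L))
      (κ := κ) hγ hC0 (by positivity)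
    filter_upwards [HJQ.eventually_step hγ, hlim.eventually (gt_mem_nhds hε)] with h hh hlt z _
    exact (HJQ.abs_qFun_sub_semiQ_le hγ hf hM hκ hC hR hL hh.1 hh.2 z).trans_lt hlt
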